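/- Let $\mathbb R^{m,1}$ be $\mathbb R^{m+1}$ with the Lorentzian metric $\langle x,y\rangle=\sum_{i=1}^m x_iy_i-x_{m+1}y_{m+1}$, and $\mathbb H^m(-1)=\{x:\langle x,x\rangle=-1,\ x_{m+1}>0\}$. Let $V\subset\mathbb R^{m,1}$ be a linear hyperplane, $u\in\mathbb R^{m,1}$, and $L(V,u)=\mathbb H^m(-1)\cap(V+u)$. Choose $0\neq\xi\in V^\perp$ with $\langle\xi,\xi\rangle\in\{1,-1,0\}$ and $a:=\langle u,\xi\rangle\ge 0$, and put $$\beta=\frac1{\sqrt{\langle\xi,\xi\rangle+a^2}},\qquad \alpha=\beta a .$$ A mean curvature flow (MCF) of an immersed Riemannian submanifold $\iota:M\to X$ in a semi-Riemannian manifold $X$ over an interval $I\ni 0$ is a smooth map $f:M\times I\to X$ such that $f(\cdot,0)=\iota$, every $f(\cdot,t)$ is an immersion with positive definite induced metric, and $\partial f/\partial t=H(\cdot,t)$, the mean curvature vector field (trace of the second fundamental form) of $f(\cdot,t)$ in $X$. Let $M$ be an (immersed) submanifold of $L(V,u)$ of dimension $n\ge1$, and let $f_1:M\times I\to L(V,u)$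 be a MCF of $M$ in $L(V,u)$. (1) If $\alpha\ne1$, put $\eta=\frac{\alpha\beta}{1-\alpha^2}\,\xi$ and $s_\alpha(t)=\frac1{2n(1-\alpha^2)}\ln\bigl(2nt(1-\alpha^2)+1\bigr)$, and let $J$ be the set of all $t$ with $2nt(1-\alpha^2)+1>0$ and $s_\alpha(t)\in I$. Then $J$ is an interval containing $0$, and $$F(x,t)=\sqrt{2nt(1-\alpha^2)+1}\,\bigl(f_1(x,s_\alpha(t))-\eta\bigr)+\eta\qquad(x\in M,\ t\in J)$$ is a MCF of $M$ in $\mathbb R^{m,1}$ over $J$. (2) If $\alpha=1$, put $J=I$. Then $$F(x,t)=f_1(x,t)-nt\beta\,\xi\qquad(x\in M,\ t\in J)$$ is a MCF of $M$ in $\mathbb R^{m,1}$ over $J$. Consequently, in both cases, if $J'\subset J$ is an interval containing $0$ over which $M$ has at most one MCF in $\mathbb R^{m,1}$, then every MCF of $M$ in $\mathbb R^{m,1}$ over $J'$ is given by the above formula. -/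

import Mathlib

open Set
open scoped Manifold ContDiff

noncomputable section

/-- The underlying vector space of the Lorentz space `ℝ^{m,1}`. -/
abbrev LorentzSpace (m : ℕ) : Type := Fin (m + 1) → ℝ

/-- The Lorentzian metric `⟨x, y⟩ = ∑_{i ≤ m} x_i y_i - x_{m+1} y_{m+1}`. -/
def lorentz {m : ℕ} (x y : LorentzSpace m) : ℝ :=
  (∑ i : Fin m, x i.castSucc * y i.castSucc) - x (Fin.last m) * y (Fin.last m)

/-- The hyperbolic space `ℍ^m(-r)`. -/
def hyperbolic (m : ℕ) (r : ℝ) : Set (LorentzSpace m) :=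
  {x | lorentz x x = -r ∧ 0 < x (Fin.last m)}

/-- `L(V, u) = ℍ^m(-1) ∩ (V + u)`. -/
def umbilicalHypersurface {m : ℕ} (V : Submodule ℝ (LorentzSpace m)) (u : LorentzSpace m) :
    Set (LorentzSpace m) :=
  {x | x ∈ hyperbolic m 1 ∧ x - u ∈ V}

/-- The tangent space at `p` of an embedded submanifold `N` of `ℝ^{m,1}`
(all of `ℝ^{m,1}` if `N = univ`). -/
def ambientTangent {m : ℕ} (N : Set (LorentzSpace m)) (p : LorentzSpace m) :
    Submodule ℝ (LorentzSpace m) :=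
  Submodule.span ℝ (tangentConeAt ℝ N p)

section Immersions

variable {m : ℕ} (n : ℕ) {M : Type*} [TopologicalSpace M] [ChartedSpace (EuclideanSpace ℝ (Fin n)) M]

/-- The map `φ : M → ℝ^{m,1}` in the preferred chart of `M` around `x`. -/
def localRep (φ : M → LorentzSpace m) (x : M) : EuclideanSpace ℝ (Fin n) → LorentzSpace m :=
  φ ∘ (extChartAt (𝓡 n) x).symm

/-- The differential of `φ` at `x`, in the preferred chart around `x`. -/
def chartD (φ : M → LorentzSpace m) (x : M) (v : EuclideanSpace ℝ (Fin n)) : LorentzSpace m :=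
  fderiv ℝ (localRep n φ x) (extChartAt (𝓡 n) x x) v

/-- The second derivative of `φ` at `x`, in the preferred chart around `x`; it is the flat
covariant derivative in `ℝ^{m,1}` of the coordinate field `dφ(w)` in the direction `dφ(v)`. -/
def chartD2 (φ : M → LorentzSpace m) (x : M) (v w : EuclideanSpace ℝ (Fin n)) : LorentzSpace m :=
  fderiv ℝ (fderiv ℝ (localRep n φ x)) (extChartAt (𝓡 n) x x) v w

/-- `φ` is a smooth immersion with positive definite induced metric. -/
def IsRiemannianImmersion (φ : M → LorentzSpace m) : Prop :=
  ContMDiff (𝓡 n) 𝓘(ℝ, LorentzSpace m) ∞ φ ∧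
    ∀ (x : M) (v : EuclideanSpace ℝ (Fin n)), v ≠ 0 → 0 < lorentz (chartD n φ x v) (chartD n φ x v)

/-- `ν` is a normal vector at `x` of the immersion `φ`, considered as an immersion into `N`. -/
def IsNormalVector (N : Set (LorentzSpace m)) (φ : M → LorentzSpace m) (x : M)
    (ν : LorentzSpace m) : Prop :=
  ν ∈ ambientTangent N (φ x) ∧ ∀ v : EuclideanSpace ℝ (Fin n), lorentz ν (chartD n φ x v) = 0

/-- `H` is the mean curvature vector at `x` of the Riemannian immersion `φ` into the embedded
semi-Riemannian submanifold `N` of `ℝ^{m,1}`: the normal vector with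
`⟨H, ν⟩ = ∑ i, ⟨A_ν b_i, b_i⟩` for all normal vectors `ν` and all orthonormal bases `b` of the
tangent space of `M` at `x`. Since the Levi-Civita connection of `N` is the tangential part of the
flat one, `⟨A_ν v, w⟩ = ⟨D²φ(v, w), ν⟩`, for `ν` tangent to `N` and normal to `φ`. -/
def IsMeanCurvatureVector (N : Set (LorentzSpace m)) (φ : M → LorentzSpace m) (x : M)
    (H : LorentzSpace m) : Prop :=
  IsNormalVector n N φ x H ∧
    ∀ b : Fin n → EuclideanSpace ℝ (Fin n),
      (∀ i j, lorentz (chartD n φ x (b i)) (chartD n φ x (b j)) = if i = j then 1 else 0) →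
      ∀ ν, IsNormalVector n N φ x ν → lorentz H ν = ∑ i, lorentz (chartD2 n φ x (b i) (b i)) ν

/-- `f` is a solution, over the interval `I` containing `0`, of the mean curvature flow in the
embedded semi-Riemannian submanifold `N` of `ℝ^{m,1}` that starts at the immersion `ι`.
Values `f x t` with `t ∉ I` are irrelevant. -/
structure IsMCF (N : Set (LorentzSpace m)) (I : Set ℝ) (ι : M → LorentzSpace m)
    (f : M → ℝ → LorentzSpace m) : Prop where
  interval : I.OrdConnected
  zero_mem : (0 : ℝ) ∈ I
  smooth : ContMDiffOn ((𝓡 n).prod 𝓘(ℝ, ℝ)) 𝓘(ℝ, LorentzSpace m) ∞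
    (fun p : M × ℝ => f p.1 p.2) (univ ×ˢ I)
  initial : ∀ x, f x 0 = ι x
  mem : ∀ t ∈ I, ∀ x, f x t ∈ N
  immersion : ∀ t ∈ I, IsRiemannianImmersion n (fun x => f x t)
  evolution : ∀ t ∈ I, ∀ x, ∃ H, IsMeanCurvatureVector n N (fun y => f y t) x H ∧
    HasDerivWithinAt (f x) H I t

/-- There is at most one mean curvature flow in `N` over `I` that starts at `ι`. -/
def AtMostOneMCF (N : Set (LorentzSpace m)) (I : Set ℝ) (ι : M → LorentzSpace m) : Prop :=
  ∀ f f' : M → ℝ → LorentzSpace m, IsMCF n N I ι f → IsMCF n N I ι f' →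
    ∀ x, ∀ t ∈ I, f x t = f' x t

/-- `F` is "the" solution of the mean curvature flow of `ι` in `N` over `J`: it is a solution, and
over every interval `J' ⊆ J` containing `0` on which the flow is unique, every solution is given
by `F`. -/
def IsTheMCF (N : Set (LorentzSpace m)) (J : Set ℝ) (ι : M → LorentzSpace m)
    (F : M → ℝ → LorentzSpace m) : Prop :=
  IsMCF n N J ι F ∧
    ∀ J' ⊆ J, AtMostOneMCF n N J' ι → ∀ F' : M → ℝ → LorentzSpace m, IsMCF n N J' ι F' →
      ∀ x, ∀ t ∈ J', F' x t = F x t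

end Immersions

/-- The time change `s_α(t) = ln(2nt(1-α²)+1) / (2n(1-α²))`. -/
def timeChange (n : ℕ) (α t : ℝ) : ℝ :=
  1 / (2 * n * (1 - α ^ 2)) * Real.log (2 * n * t * (1 - α ^ 2) + 1)

end

/-! ### The Lorentzian metric -/

section LorentzAlgebra

variable {m : ℕ} (x y z : LorentzSpace m) (c : ℝ)

/-! Write `k = ⟨ξ, ξ⟩` and `Q = k + a²`. At a point `p` of `L(V, u)` the normal space of `L(V, u)`
in the Lorentz space is spanned by `p` and `ξ`, with `⟨p, p⟩ = -1`, `⟨p, ξ⟩ = a`, and Gram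
determinant `-Q`; `lorentz_self_add_sq_pos` shows `Q > 0`. Differentiating `⟨φ, φ⟩ = -1` and `⟨φ, ξ⟩
= a` twice shows that `D²φ(v, w)` pairs with `p` to `-⟨dφ v, dφ w⟩` and with `ξ` to `0`. Hence the
two mean curvature vectors differ by `(n / Q) (k p - a ξ)`
(`IsMeanCurvatureVector.of_umbilicalHypersurface`).

Since `1 - α² = k / Q` and `αβ = a / Q`, this difference is `n (1 - α²) (p - η)` if `α ≠ 1`, and the
constant `-nβξ` if `α = 1`. In the first case a homothety about `η` with a time change absorbs it
(`IsMCF.homothety`), in the second a translation linear in time does (`IsMCF.translate`). -/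

theorem lorentz_comm : lorentz x y = lorentz y x := by
  simp only [lorentz, mul_comm]

theorem lorentz_add_left : lorentz (x + y) z = lorentz x z + lorentz y z := by
  simp only [lorentz, Pi.add_apply, add_mul, Finset.sum_add_distrib]
  ring

theorem lorentz_smul_left : lorentz (c • x) y = c * lorentz x y := by
  simp only [lorentz, Pi.smul_apply, smul_eq_mul, mul_sub, Finset.mul_sum, mul_assoc]

theorem lorentz_add_right : lorentz x (y + z) = lorentz x y + lorentz x z := by
  rw [lorentz_comm, lorentz_add_left, lorentz_comm y, lorentz_comm z]

theorem lorentz_smul_right : lorentz x (c • y) = c * lorentz x y := by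
  rw [lorentz_comm, lorentz_smul_left, lorentz_comm y]

/-- The Lorentzian metric as a continuous bilinear map. -/
noncomputable def lorentzCLM (m : ℕ) : LorentzSpace m →L[ℝ] LorentzSpace m →L[ℝ] ℝ :=
  (LinearMap.mk₂ ℝ lorentz lorentz_add_left (fun c x y => lorentz_smul_left x y c)
    lorentz_add_right (fun c x y => lorentz_smul_right x y c)).toContinuousBilinearMap

theorem lorentzCLM_apply : lorentzCLM m x y = lorentz x y := rfl

theorem lorentz_zero_left : lorentz 0 y = 0 := by
  simp [lorentz]

theorem lorentz_sub_left : lorentz (x - y) z = lorentz x z - lorentz y z := by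
  simp only [← lorentzCLM_apply, map_sub, sub_apply]

theorem lorentz_sub_right : lorentz x (y - z) = lorentz x y - lorentz x z := by
  simp only [← lorentzCLM_apply, map_sub]

end LorentzAlgebra

section LorentzGeometry

variable {m : ℕ}

/-- The Lorentzian metric is nondegenerate. -/
theorem exists_lorentz_ne_zero {ξ : LorentzSpace m} (hξ : ξ ≠ 0) : ∃ v, lorentz v ξ ≠ 0 := by
  by_contra! h
  apply hξ
  funext i
  have hi := h (Pi.single i 1)
  refine Fin.lastCases (fun hi => ?_) (fun j hj => ?_) i hi
  · simpa [lorentz, Pi.single_apply, Fin.castSucc_ne_last] using hi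
  · simpa [lorentz, Pi.single_apply, Fin.castSucc_inj, (Fin.castSucc_ne_last j).symm,
      Finset.sum_ite_eq'] using hj

/-- A hyperplane is the orthogonal complement of each of its nonzero normal vectors. -/
theorem mem_of_lorentz_eq_zero {V : Submodule ℝ (LorentzSpace m)} (hV : Module.finrank ℝ V = m)
    {ξ : LorentzSpace m} (hξ0 : ξ ≠ 0) (hξV : ∀ v ∈ V, lorentz v ξ = 0)
    {w : LorentzSpace m} (hw : lorentz w ξ = 0) : w ∈ V := by
  set K := LinearMap.ker ((lorentzCLM m).flip ξ).toLinearMap with hK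
  have hmem : ∀ v, v ∈ K ↔ lorentz v ξ = 0 := fun v => Iff.rfl
  have hle : V ≤ K := fun v hv => (hmem v).2 (hξV v hv)
  have hlt : Module.finrank ℝ K < m + 1 := by
    have hne : K ≠ ⊤ := by
      obtain ⟨v, hv⟩ := exists_lorentz_ne_zero hξ0
      intro h
      exact hv ((hmem v).1 (h ▸ Submodule.mem_top))
    simpa using Submodule.finrank_lt hne
  -- Only dimensions are compared, so a null `ξ`, which lies in `V` itself, is covered.
  have : V = K := Submodule.eq_of_le_of_finrank_le hle (by omega)
  rw [this]
  exact (hmem w).2 hw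

/-- Cauchy–Schwarz in the first `m` coordinates, with the sums involving `p` eliminated by `hp` and
`hw`. It makes the metric positive definite on the orthogonal complement of `p`. -/
theorem sum_sq_le_lorentz_self_mul {p w : LorentzSpace m} (hp : lorentz p p = -1)
    (hw : lorentz w p = 0) :
    ∑ i : Fin m, w i.castSucc ^ 2 ≤ lorentz w w * p (Fin.last m) ^ 2 := by
  have hcs := Finset.sum_mul_sq_le_sq_mul_sq Finset.univ
    (fun i : Fin m => w i.castSucc) (fun i : Fin m => p i.castSucc)
  simp only [lorentz, ← sq] at *
  have h1 : ∑ i : Fin m, p i.castSucc ^ 2 = p (Fin.last m) ^ 2 - 1 := by linarith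
  have h2 : ∑ i : Fin m, w i.castSucc * p i.castSucc = w (Fin.last m) * p (Fin.last m) := by
    linarith
  rw [h1, h2] at hcs
  linarith

/-- The orthogonal complement of a point of hyperbolic space is spacelike. -/
theorem lorentz_self_nonneg_of_orthogonal {p w : LorentzSpace m} (hp : lorentz p p = -1)
    (hp0 : 0 < p (Fin.last m)) (hw : lorentz w p = 0) : 0 ≤ lorentz w w := by
  have h := sum_sq_le_lorentz_self_mul hp hw
  have h' : 0 ≤ ∑ i : Fin m, w i.castSucc ^ 2 := Finset.sum_nonneg fun i _ => sq_nonneg _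
  exact nonneg_of_mul_nonneg_left (h'.trans h) (by positivity)

theorem eq_zero_of_lorentz_self_eq_zero {p w : LorentzSpace m} (hp : lorentz p p = -1)
    (hw : lorentz w p = 0) (h0 : lorentz w w = 0) : w = 0 := by
  have h := sum_sq_le_lorentz_self_mul hp hw
  have hs : ∑ i : Fin m, w i.castSucc ^ 2 = 0 :=
    le_antisymm (by simpa [h0] using h) (Finset.sum_nonneg fun i _ => sq_nonneg _)
  have hl : w (Fin.last m) = 0 := by
    simp only [lorentz, ← sq] at h0
    exact pow_eq_zero_iff two_ne_zero |>.1 (by linarith)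
  rw [Finset.sum_eq_zero_iff_of_nonneg fun i _ => sq_nonneg _] at hs
  funext i
  refine Fin.lastCases hl (fun j => ?_) i
  simpa using hs j (Finset.mem_univ j)

/-- Along `L(V, u)`, the vector `ξ + a p` is tangent to hyperbolic space. -/
theorem lorentz_add_smul_self_eq {p ξ : LorentzSpace m} {a : ℝ} (hp : lorentz p p = -1)
    (hpξ : lorentz p ξ = a) :
    lorentz (ξ + a • p) p = 0 ∧ lorentz (ξ + a • p) (ξ + a • p) = lorentz ξ ξ + a ^ 2 := by
  have h : lorentz ξ p = a := by rw [lorentz_comm, hpξ]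
  simp only [lorentz_add_left, lorentz_add_right, lorentz_smul_left, lorentz_smul_right, hp, hpξ, h]
  constructor <;> ring

theorem lorentz_eq_of_mem_umbilicalHypersurface {V : Submodule ℝ (LorentzSpace m)}
    {u ξ p : LorentzSpace m} (hξV : ∀ v ∈ V, lorentz v ξ = 0)
    (hp : p ∈ umbilicalHypersurface V u) : lorentz p ξ = lorentz u ξ := by
  have := hξV _ hp.2
  rw [lorentz_sub_left] at this
  linarith

/-! ### Tangent spaces -/

theorem ambientTangent_univ (p : LorentzSpace m) : ambientTangent univ p = ⊤ := by
  simp [ambientTangent]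

/-- The differential of a function which is constant on `N` vanishes on the tangent spaces
of `N`. -/
theorem fderiv_eq_zero_of_mem_ambientTangent {N : Set (LorentzSpace m)} {p w : LorentzSpace m}
    {g : LorentzSpace m → ℝ} {g' : LorentzSpace m →L[ℝ] ℝ} {c : ℝ} (hg : HasFDerivAt g g' p)
    (hc : ∀ q ∈ N, g q = c) (hw : w ∈ ambientTangent N p) : g' w = 0 := by
  have hle : ambientTangent N p ≤ LinearMap.ker g'.toLinearMap := by
    refine Submodule.span_le.2 fun v hv => ?_
    have h1 := hg.hasFDerivWithinAt (s := N) |>.mapsTo_tangent_cone hv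
    have hsub : g '' N ⊆ {c} := by
      rintro _ ⟨q, hq, rfl⟩
      exact hc q hq
    have h2 := tangentConeAt_mono hsub h1
    -- A singleton has no accumulation points, so its tangent cone contains at most `0`.
    have h3 : ¬ AccPt (g p) (Filter.principal {c}) := fun h =>
      Set.Infinite.of_accPt h (finite_singleton c)
    exact tangentConeAt_subset_zero h3 h2
  exact hle hw

theorem lorentz_eq_zero_of_mem_ambientTangent {V : Submodule ℝ (LorentzSpace m)}
    {u ξ p w : LorentzSpace m} (hξV : ∀ v ∈ V, lorentz v ξ = 0)
    (hw : w ∈ ambientTangent (umbilicalHypersurface V u) p) :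
    lorentz w p = 0 ∧ lorentz w ξ = 0 := by
  constructor
  · have hd : HasFDerivAt (fun q : LorentzSpace m => lorentzCLM m q q) _ p :=
      (lorentzCLM m).hasFDerivAt_of_bilinear (hasFDerivAt_id p) (hasFDerivAt_id p)
    have := fderiv_eq_zero_of_mem_ambientTangent hd (c := -1) (fun q hq => hq.1.1) hw
    simp [lorentzCLM_apply, lorentz_comm p w] at this
    linarith
  · exact fderiv_eq_zero_of_mem_ambientTangent ((lorentzCLM m).flip ξ).hasFDerivAt
      (fun q hq => lorentz_eq_of_mem_umbilicalHypersurface hξV hq) hw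

theorem mem_ambientTangent_of_hasDerivAt {N : Set (LorentzSpace m)} {p w : LorentzSpace m}
    {γ : ℝ → LorentzSpace m} (hγ : HasDerivAt γ w 0) (h0 : γ 0 = p)
    (hN : ∀ᶠ t in nhds 0, γ t ∈ N) : w ∈ ambientTangent N p := by
  subst h0
  refine Submodule.subset_span ?_
  have h1 : (1 : ℝ) ∈ tangentConeAt ℝ (γ ⁻¹' N) 0 := by
    have hN' : γ ⁻¹' N ∈ nhds 0 := hN
    rw [tangentConeAt_of_mem_nhds hN']
    trivial
  have h2 := (hγ.hasFDerivAt.hasFDerivWithinAt (s := γ ⁻¹' N)).mapsTo_tangent_cone h1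
  simpa using tangentConeAt_mono (image_preimage_subset γ N) h2

/-- The tangent space of `L(V, u)` at `p` contains the orthogonal complement of `p` and `ξ`. -/
theorem mem_ambientTangent_of_lorentz_eq_zero {V : Submodule ℝ (LorentzSpace m)}
    (hV : Module.finrank ℝ V = m) {u ξ p w : LorentzSpace m} (hξ0 : ξ ≠ 0)
    (hξV : ∀ v ∈ V, lorentz v ξ = 0) (hp : p ∈ umbilicalHypersurface V u)
    (hQ : 0 < lorentz ξ ξ + lorentz u ξ ^ 2) (hwp : lorentz w p = 0) (hwξ : lorentz w ξ = 0) :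
    w ∈ ambientTangent (umbilicalHypersurface V u) p := by
  have hpξ := lorentz_eq_of_mem_umbilicalHypersurface hξV hp
  set a := lorentz u ξ with ha
  set k := lorentz ξ ξ with hk
  -- `ζ` is orthogonal to `ξ` and `w`, with `⟨ζ, p⟩ = -(k + a²)` and `⟨ζ, ζ⟩ = -k (k + a²)`. So `p +
  -- t w + g ζ` stays in `V + u`, and has norm `-1` exactly when `k g² + 2 g = q t²`.
  set ζ : LorentzSpace m := k • p - a • ξ with hζ
  set q := lorentz w w / (k + a ^ 2) with hq
  have hpp : lorentz p p = -1 := hp.1.1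
  have hξp : lorentz ξ p = a := by rw [lorentz_comm, hpξ]
  have hpw : lorentz p w = 0 := by rw [lorentz_comm, hwp]
  have hξw : lorentz ξ w = 0 := by rw [lorentz_comm, hwξ]
  let S : ℝ → ℝ := fun t => Real.sqrt (1 + k * (q * t ^ 2))
  -- The root vanishing at `t = 0`, rationalised so that `k = 0` is allowed.
  let g : ℝ → ℝ := fun t => q * t ^ 2 / (1 + S t)
  let γ : ℝ → LorentzSpace m := fun t => p + t • w + g t • ζ
  have hnum : HasDerivAt (fun t : ℝ => q * t ^ 2) 0 0 := by
    simpa using (hasDerivAt_pow 2 (0 : ℝ)).const_mul q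
  have hS : HasDerivAt S 0 0 := by
    simpa using ((hnum.const_mul k).const_add 1).sqrt (by simp)
  have hg : HasDerivAt g 0 0 := by
    have h := hnum.div (hS.const_add 1) (by simp [S])
    have h0 : (0 * (1 + S 0) - q * 0 ^ 2 * 0) / (1 + S 0) ^ 2 = 0 := by simp
    exact h.congr_deriv h0
  have hγ : HasDerivAt γ w 0 := by
    have h := (((hasDerivAt_id (0 : ℝ)).smul_const w).const_add p).add (hg.smul_const ζ)
    have h0 : (1 : ℝ) • w + (0 : ℝ) • ζ = w := by simp
    exact h.congr_deriv h0
  have hγ0 : γ 0 = p := by simp [γ, g]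
  refine mem_ambientTangent_of_hasDerivAt hγ hγ0 ?_
  have hlast : ∀ᶠ t in nhds (0 : ℝ), 0 < γ t (Fin.last m) := by
    have hc : ContinuousAt (fun t => γ t (Fin.last m)) 0 :=
      (continuous_apply (Fin.last m)).continuousAt.comp hγ.continuousAt
    refine hc.eventually (lt_mem_nhds ?_)
    simpa [hγ0] using hp.1.2
  have hpos : ∀ᶠ t in nhds (0 : ℝ), 0 < 1 + k * (q * t ^ 2) := by
    have hc : ContinuousAt (fun t : ℝ => 1 + k * (q * t ^ 2)) 0 := by fun_prop
    refine hc.eventually (lt_mem_nhds ?_)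
    simp
  filter_upwards [hlast, hpos] with t ht1 ht2
  have hS2 : S t ^ 2 = 1 + k * (q * t ^ 2) := Real.sq_sqrt ht2.le
  have hS0 : 0 ≤ S t := Real.sqrt_nonneg _
  have hgeq : g t * (1 + S t) = q * t ^ 2 := div_mul_cancel₀ _ (by positivity)
  have hquad : k * g t ^ 2 + 2 * g t = q * t ^ 2 := by
    have h1 : (1 + S t) ^ 2 ≠ 0 := by positivity
    apply mul_right_cancel₀ h1
    linear_combination (k * (g t * (1 + S t) + q * t ^ 2) + 2 * (1 + S t)) * hgeq
      - q * t ^ 2 * hS2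
  have hww : lorentz w w = q * (k + a ^ 2) := (div_mul_cancel₀ _ hQ.ne').symm
  refine ⟨⟨?_, ht1⟩, ?_⟩
  · simp only [γ, hζ, lorentz_add_left, lorentz_add_right, lorentz_smul_left, lorentz_smul_right,
      lorentz_sub_left, lorentz_sub_right, hpp, hpξ, hξp, hwp, hwξ, hpw, hξw, ← hk, hww]
    linear_combination (-(k + a ^ 2)) * hquad
  · refine mem_of_lorentz_eq_zero hV hξ0 hξV ?_
    simp only [γ, hζ, lorentz_add_left, lorentz_smul_left, lorentz_sub_left, hpξ, hwξ, ← hk, ← ha]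
    ring

end LorentzGeometry

/-! ### Immersions in charts -/

section Charts

variable {m n : ℕ} {M : Type*} [TopologicalSpace M] [ChartedSpace (EuclideanSpace ℝ (Fin n)) M]

theorem contDiffOn_localRep [IsManifold (𝓡 n) ∞ M] {φ : M → LorentzSpace m}
    (hφ : ContMDiff (𝓡 n) 𝓘(ℝ, LorentzSpace m) ∞ φ) (x : M) :
    ContDiffOn ℝ ∞ (localRep n φ x) (extChartAt (𝓡 n) x).target :=
  contMDiffOn_iff_contDiffOn.1 (hφ.comp_contMDiffOn (contMDiffOn_extChartAt_symm x))

theorem localRep_extChartAt (φ : M → LorentzSpace m) (x : M) :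
    localRep n φ x (extChartAt (𝓡 n) x x) = φ x := by
  simp [localRep]

theorem fderiv_localRep_smul_add_const (φ : M → LorentzSpace m) (r : ℝ) (c : LorentzSpace m)
    (x : M) :
    fderiv ℝ (localRep n (fun y => r • φ y + c) x) = r • fderiv ℝ (localRep n φ x) := by
  have h : localRep n (fun y => r • φ y + c) x = fun y => (r • localRep n φ x) y + c := rfl
  funext y
  rw [h, fderiv_add_const]
  exact congrFun (fderiv_const_smul_field r) y

theorem chartD_smul_add_const (φ : M → LorentzSpace m) (r : ℝ) (c : LorentzSpace m) (x : M)
    (v : EuclideanSpace ℝ (Fin n)) :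
    chartD n (fun y => r • φ y + c) x v = r • chartD n φ x v := by
  rw [chartD, fderiv_localRep_smul_add_const]
  rfl

theorem chartD2_smul_add_const (φ : M → LorentzSpace m) (r : ℝ) (c : LorentzSpace m) (x : M)
    (v w : EuclideanSpace ℝ (Fin n)) :
    chartD2 n (fun y => r • φ y + c) x v w = r • chartD2 n φ x v w := by
  have h : fderiv ℝ (r • fderiv ℝ (localRep n φ x)) = r • fderiv ℝ (fderiv ℝ (localRep n φ x)) :=
    fderiv_const_smul_field (F := EuclideanSpace ℝ (Fin n) →L[ℝ] LorentzSpace m) r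
  rw [chartD2, fderiv_localRep_smul_add_const, h]
  rfl

/-- The factor moves into the tangent vectors: an orthonormal frame `b` for the rescaled immersion
gives the orthonormal frame `r • b` for `φ`. -/
theorem lorentz_chartD_smul_add_const (φ : M → LorentzSpace m) (r : ℝ) (c : LorentzSpace m) (x : M)
    (v w : EuclideanSpace ℝ (Fin n)) :
    lorentz (chartD n (fun y => r • φ y + c) x v) (chartD n (fun y => r • φ y + c) x w) =
      lorentz (chartD n φ x (r • v)) (chartD n φ x (r • w)) := by
  simp only [chartD_smul_add_const]
  simp only [chartD, map_smul]

/-- Homotheties and translations preserve Riemannian immersions. -/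
theorem IsRiemannianImmersion.smul_add_const {φ : M → LorentzSpace m}
    (hφ : IsRiemannianImmersion n φ) {r : ℝ} (hr : r ≠ 0) (c : LorentzSpace m) :
    IsRiemannianImmersion n (fun y => r • φ y + c) := by
  refine ⟨?_, fun x v hv => ?_⟩
  · have h : ContDiff ℝ ∞ fun z : LorentzSpace m => r • z + c := by fun_prop
    exact h.contMDiff.comp hφ.1
  · rw [lorentz_chartD_smul_add_const]
    exact hφ.2 x _ (smul_ne_zero hr hv)

/-- The mean curvature vector under a homothety of ratio `r` is multiplied by `r⁻¹`. -/
theorem IsMeanCurvatureVector.smul_add_const {φ : M → LorentzSpace m} {x : M} {H : LorentzSpace m}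
    (hH : IsMeanCurvatureVector n univ φ x H) {r : ℝ} (hr : r ≠ 0) (c : LorentzSpace m) :
    IsMeanCurvatureVector n univ (fun y => r • φ y + c) x (r⁻¹ • H) := by
  have hnormal : ∀ ν, IsNormalVector n univ (fun y => r • φ y + c) x ν →
      IsNormalVector n univ φ x ν := by
    refine fun ν hν => ⟨by simp [ambientTangent_univ], fun v => ?_⟩
    have h := hν.2 v
    rw [chartD_smul_add_const, lorentz_smul_right] at h
    exact (mul_eq_zero.1 h).resolve_left hr
  refine ⟨⟨by simp [ambientTangent_univ], fun v => ?_⟩, fun b hb ν hν => ?_⟩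
  · rw [chartD_smul_add_const, lorentz_smul_right, lorentz_smul_left, hH.1.2 v]
    simp
  · have h := hH.2 (fun i => r • b i) (fun i j => by
      rw [← lorentz_chartD_smul_add_const φ r c, hb i j]) ν (hnormal ν hν)
    rw [lorentz_smul_left, h, Finset.mul_sum]
    refine Finset.sum_congr rfl fun i _ => ?_
    have h2 : chartD2 n φ x (r • b i) (r • b i) = (r * r) • chartD2 n φ x (b i) (b i) := by
      simp [chartD2, smul_smul]
    rw [h2, chartD2_smul_add_const, lorentz_smul_left, lorentz_smul_left]
    field_simp

/-- First and second derivatives of an immersion into an affine hyperplane. -/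
theorem lorentz_chartD_eq_zero_of_const [IsManifold (𝓡 n) ∞ M] {φ : M → LorentzSpace m}
    (hφ : ContMDiff (𝓡 n) 𝓘(ℝ, LorentzSpace m) ∞ φ) {ξ : LorentzSpace m} {a : ℝ}
    (h : ∀ y, lorentz (φ y) ξ = a) (x : M) (v w : EuclideanSpace ℝ (Fin n)) :
    lorentz (chartD n φ x v) ξ = 0 ∧ lorentz (chartD2 n φ x v w) ξ = 0 := by
  have hopen := isOpen_extChartAt_target (I := 𝓡 n) x
  have hsm := contDiffOn_localRep hφ x
  have hx := mem_extChartAt_target (I := 𝓡 n) x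
  -- Proved on the whole chart target so that it can be differentiated once more.
  have h1 : ∀ y ∈ (extChartAt (𝓡 n) x).target, ∀ w,
      lorentz (fderiv ℝ (localRep n φ x) y w) ξ = 0 := by
    intro y hy w
    have hd := ((hsm.contDiffAt (hopen.mem_nhds hy)).differentiableAt (by simp)).hasFDerivAt
    have hd1 := ((lorentzCLM m).flip ξ).hasFDerivAt.comp y hd
    have hd2 : HasFDerivAt (((lorentzCLM m).flip ξ) ∘ localRep n φ x)
        (0 : EuclideanSpace ℝ (Fin n) →L[ℝ] ℝ) y := by
      have : (((lorentzCLM m).flip ξ) ∘ localRep n φ x) = fun _ => a := by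
        funext z
        exact h _
      rw [this]
      exact hasFDerivAt_const a y
    exact congrArg (fun L => L w) (hd1.unique hd2)
  refine ⟨h1 _ hx v, ?_⟩
  have hd := (((hsm.contDiffAt (hopen.mem_nhds hx)).fderiv_right (m := 1)
    (WithTop.coe_le_coe.2 le_top)).differentiableAt
    (by simp)).hasFDerivAt.clm_apply (hasFDerivAt_const w _)
  have hd1 := ((lorentzCLM m).flip ξ).hasFDerivAt.comp _ hd
  have hd2 : HasFDerivAt (((lorentzCLM m).flip ξ) ∘ fun y => fderiv ℝ (localRep n φ x) y w)
      (0 : EuclideanSpace ℝ (Fin n) →L[ℝ] ℝ) (extChartAt (𝓡 n) x x) := by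
    refine (hasFDerivAt_const (0 : ℝ) _).congr_of_eventuallyEq ?_
    filter_upwards [hopen.mem_nhds hx] with y hy using h1 y hy w
  simpa [lorentzCLM_apply, chartD2] using congrArg (fun L => L v) (hd1.unique hd2)

/-- First and second derivatives of an immersion into a quadric. -/
theorem lorentz_chartD_of_quadric [IsManifold (𝓡 n) ∞ M] {φ : M → LorentzSpace m}
    (hφ : ContMDiff (𝓡 n) 𝓘(ℝ, LorentzSpace m) ∞ φ) {k : ℝ}
    (h : ∀ y, lorentz (φ y) (φ y) = k) (x : M) (v w : EuclideanSpace ℝ (Fin n)) :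
    lorentz (chartD n φ x v) (φ x) = 0 ∧
      lorentz (chartD2 n φ x v w) (φ x) = - lorentz (chartD n φ x v) (chartD n φ x w) := by
  have hopen := isOpen_extChartAt_target (I := 𝓡 n) x
  have hsm := contDiffOn_localRep hφ x
  have hx := mem_extChartAt_target (I := 𝓡 n) x
  have hdiff : ∀ y ∈ (extChartAt (𝓡 n) x).target, HasFDerivAt (localRep n φ x) _ y := fun y hy =>
    ((hsm.contDiffAt (hopen.mem_nhds hy)).differentiableAt (by simp)).hasFDerivAt
  have h1 : ∀ y ∈ (extChartAt (𝓡 n) x).target, ∀ w,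
      lorentz (fderiv ℝ (localRep n φ x) y w) (localRep n φ x y) = 0 := by
    intro y hy w
    have hd1 := (lorentzCLM m).hasFDerivAt_of_bilinear (hdiff y hy) (hdiff y hy)
    have hd2 : HasFDerivAt (fun z => lorentzCLM m (localRep n φ x z) (localRep n φ x z))
        (0 : EuclideanSpace ℝ (Fin n) →L[ℝ] ℝ) y := by
      have : (fun z => lorentzCLM m (localRep n φ x z) (localRep n φ x z)) = fun _ => k := by
        funext z
        exact h _
      rw [this]
      exact hasFDerivAt_const k y
    have h0 := congrArg (fun L => L w) (hd1.unique hd2)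
    simp [lorentzCLM_apply, lorentz_comm (localRep n φ x y)] at h0
    linarith
  constructor
  · have h0 := h1 _ hx v
    rwa [localRep_extChartAt] at h0
  have hd := (((hsm.contDiffAt (hopen.mem_nhds hx)).fderiv_right (m := 1)
    (WithTop.coe_le_coe.2 le_top)).differentiableAt
    (by simp)).hasFDerivAt.clm_apply (hasFDerivAt_const w _)
  have hd1 := (lorentzCLM m).hasFDerivAt_of_bilinear hd (hdiff _ hx)
  have hd2 : HasFDerivAt
      (fun y => lorentzCLM m (fderiv ℝ (localRep n φ x) y w) (localRep n φ x y))
      (0 : EuclideanSpace ℝ (Fin n) →L[ℝ] ℝ) (extChartAt (𝓡 n) x x) := by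
    refine (hasFDerivAt_const (0 : ℝ) _).congr_of_eventuallyEq ?_
    filter_upwards [hopen.mem_nhds hx] with y hy using h1 y hy w
  have h0 := congrArg (fun L => L v) (hd1.unique hd2)
  simp only [add_apply, ContinuousLinearMap.precompR_apply, ContinuousLinearMap.precompL_apply,
    ContinuousLinearMap.compL_apply, ContinuousLinearMap.comp_apply,
    ContinuousLinearMap.comp_zero, zero_add, ContinuousLinearMap.flip_apply, lorentzCLM_apply,
    localRep_extChartAt, zero_apply] at h0
  rw [lorentz_comm (chartD n φ x v)]
  simp only [chartD, chartD2]
  linarith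

/-- The number is the norm of `ξ + a φ y`, which is orthogonal to `φ y` and hence not timelike. If
it were zero, `ξ + a φ y` would vanish for every `y`; then `a ≠ 0` and `φ` is constant, impossible
for an immersion of positive dimension. -/
theorem lorentz_self_add_sq_pos {φ : M → LorentzSpace m} (hn : 0 < n) (hφ : IsRiemannianImmersion n φ)
    {V : Submodule ℝ (LorentzSpace m)} {u ξ : LorentzSpace m} (hξ0 : ξ ≠ 0)
    (hξV : ∀ v ∈ V, lorentz v ξ = 0) (hφL : ∀ x, φ x ∈ umbilicalHypersurface V u) (x : M) :
    0 < lorentz ξ ξ + lorentz u ξ ^ 2 := by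
  have hkey : ∀ y, lorentz (ξ + lorentz u ξ • φ y) (φ y) = 0 ∧ _ := fun y =>
    lorentz_add_smul_self_eq (hφL y).1.1 (lorentz_eq_of_mem_umbilicalHypersurface hξV (hφL y))
  refine lt_of_le_of_ne ?_ fun h0 => ?_
  · rw [← (hkey x).2]
    exact lorentz_self_nonneg_of_orthogonal (hφL x).1.1 (hφL x).1.2 (hkey x).1
  · have hz : ∀ y, ξ + lorentz u ξ • φ y = 0 := fun y =>
      eq_zero_of_lorentz_self_eq_zero (hφL y).1.1 (hkey y).1 ((hkey y).2.trans h0.symm)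
    have ha : lorentz u ξ ≠ 0 := by
      intro ha
      have := hz x
      rw [ha] at this
      simp at this
      exact hξ0 this
    have hconst : φ = fun _ => φ x := by
      funext y
      have := (hz y).trans (hz x).symm
      exact smul_right_injective _ ha (add_left_cancel this)
    have hD : ∀ v, chartD n φ x v = 0 := by
      intro v
      have hl : localRep n φ x = fun _ => φ x := by
        rw [hconst]
        rfl
      simp [chartD, hl]
    have hpos := hφ.2 x (EuclideanSpace.single ⟨0, hn⟩ 1) (by simp)
    rw [hD, lorentz_zero_left] at hpos
    exact lt_irrefl _ hpos

/-- The mean curvature vector in `ℝ^{m,1}` of a submanifold of `L(V, u)`. -/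
theorem IsMeanCurvatureVector.of_umbilicalHypersurface
    [IsManifold (𝓡 n) ∞ M] {φ : M → LorentzSpace m} (hφ : IsRiemannianImmersion n φ)
    {V : Submodule ℝ (LorentzSpace m)} (hV : Module.finrank ℝ V = m) {u ξ : LorentzSpace m}
    (hξ0 : ξ ≠ 0) (hξV : ∀ v ∈ V, lorentz v ξ = 0)
    (hφL : ∀ x, φ x ∈ umbilicalHypersurface V u)
    (hQ : 0 < lorentz ξ ξ + lorentz u ξ ^ 2) {x : M} {H : LorentzSpace m}
    (hH : IsMeanCurvatureVector n (umbilicalHypersurface V u) φ x H) :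
    IsMeanCurvatureVector n univ φ x (H + (n / (lorentz ξ ξ + lorentz u ξ ^ 2)) •
      (lorentz ξ ξ • φ x - lorentz u ξ • ξ)) := by
  have hφξ : ∀ y, lorentz (φ y) ξ = lorentz u ξ := fun y =>
    lorentz_eq_of_mem_umbilicalHypersurface hξV (hφL y)
  obtain ⟨hHp, hHξ⟩ := lorentz_eq_zero_of_mem_ambientTangent hξV hH.1.1
  have hquad := lorentz_chartD_of_quadric hφ.1 (k := -1) (fun y => (hφL y).1.1) x
  have hlin := lorentz_chartD_eq_zero_of_const hφ.1 hφξ x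
  have hpD : ∀ v, lorentz (φ x) (chartD n φ x v) = 0 := fun v => by
    rw [lorentz_comm, (hquad v v).1]
  have hξD : ∀ v, lorentz ξ (chartD n φ x v) = 0 := fun v => by
    rw [lorentz_comm, (hlin v v).1]
  have hpp : lorentz (φ x) (φ x) = -1 := (hφL x).1.1
  have hpξ := hφξ x
  have hξp : lorentz ξ (φ x) = lorentz u ξ := by rw [lorentz_comm, hpξ]
  set a := lorentz u ξ with ha
  set k := lorentz ξ ξ with hk
  refine ⟨⟨by simp [ambientTangent_univ], fun v => ?_⟩, fun b hb ν hν => ?_⟩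
  · simp only [lorentz_add_left, lorentz_smul_left, lorentz_sub_left, hpD, hξD, hH.1.2 v]
    ring
  · -- Split `ν` into a part tangent to `L(V, u)` and a combination of `φ x` and `ξ`.
    set Q := k + a ^ 2 with hQdef
    -- `c` and `d` solve `-c + a d = ⟨ν, φ x⟩` and `a c + k d = ⟨ν, ξ⟩`.
    set c := (a * lorentz ν ξ - k * lorentz ν (φ x)) / Q with hc
    set d := (a * lorentz ν (φ x) + lorentz ν ξ) / Q with hd
    have hcQ : c * Q = a * lorentz ν ξ - k * lorentz ν (φ x) := div_mul_cancel₀ _ hQ.ne'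
    have hdQ : d * Q = a * lorentz ν (φ x) + lorentz ν ξ := div_mul_cancel₀ _ hQ.ne'
    set τ := ν - c • φ x - d • ξ with hτ
    have hντ : ν = τ + c • φ x + d • ξ := by
      rw [hτ]
      abel
    have hτp : lorentz τ (φ x) = 0 := by
      simp only [hτ, lorentz_sub_left, lorentz_smul_left, hpp, hξp]
      apply mul_right_cancel₀ hQ.ne'
      linear_combination hcQ - a * hdQ + lorentz ν (φ x) * hQdef
    have hτξ : lorentz τ ξ = 0 := by
      simp only [hτ, lorentz_sub_left, lorentz_smul_left, hpξ, ← hk]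
      apply mul_right_cancel₀ hQ.ne'
      linear_combination (-a) * hcQ - k * hdQ + lorentz ν ξ * hQdef
    have hτN : IsNormalVector n (umbilicalHypersurface V u) φ x τ := by
      refine ⟨mem_ambientTangent_of_lorentz_eq_zero hV hξ0 hξV (hφL x) hQ hτp hτξ, fun v => ?_⟩
      simp only [hτ, lorentz_sub_left, lorentz_smul_left, hpD, hξD, hν.2 v]
      ring
    have hpτ : lorentz (φ x) τ = 0 := by rw [lorentz_comm, hτp]
    have hξτ : lorentz ξ τ = 0 := by rw [lorentz_comm, hτξ]
    -- Each `D²φ(b i, b i)` pairs to `-1` with `φ x` and to `0` with `ξ`, so `d` drops out.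
    have hsum : ∑ i, lorentz (chartD2 n φ x (b i) (b i)) ν = lorentz H τ - n * c := by
      rw [hH.2 b hb τ hτN]
      have : ∀ i, lorentz (chartD2 n φ x (b i) (b i)) ν =
          lorentz (chartD2 n φ x (b i) (b i)) τ - c := fun i => by
        rw [hντ]
        simp only [lorentz_add_right, lorentz_smul_right, (hlin (b i) (b i)).2,
          (hquad (b i) (b i)).2, hb i i, if_true]
        ring
      simp [this, Finset.sum_sub_distrib]
    rw [hsum, hντ]
    simp only [lorentz_add_left, lorentz_add_right, lorentz_smul_left, lorentz_smul_right,
      lorentz_sub_left, hpp, hpξ, hξp, hpτ, hξτ, hHp, hHξ, ← hk]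
    field_simp
    ring

end Charts

/-! ### The time change -/

section TimeChange

variable {n : ℕ} {α : ℝ}

theorem timeChange_zero : timeChange n α 0 = 0 := by
  simp [timeChange]

theorem contDiffOn_timeChange :
    ContDiffOn ℝ ∞ (timeChange n α) {t | 0 < 2 * n * t * (1 - α ^ 2) + 1} := by
  unfold timeChange
  refine contDiffOn_const.mul (ContDiffOn.log ?_ fun t ht => ne_of_gt ht)
  fun_prop

theorem hasDerivAt_timeChange (hn : 0 < n) (hα : 1 - α ^ 2 ≠ 0) {t : ℝ}
    (ht : 0 < 2 * n * t * (1 - α ^ 2) + 1) :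
    HasDerivAt (timeChange n α) (2 * n * t * (1 - α ^ 2) + 1)⁻¹ t := by
  have hn' : (n : ℝ) ≠ 0 := by positivity
  have h1 : HasDerivAt (fun t : ℝ => 2 * n * t * (1 - α ^ 2) + 1) (2 * n * (1 - α ^ 2)) t := by
    have := (((hasDerivAt_id t).const_mul (2 * (n : ℝ))).mul_const (1 - α ^ 2)).add_const 1
    simpa using this
  refine ((h1.log ht.ne').const_mul (1 / (2 * n * (1 - α ^ 2)))).congr_deriv ?_
  have := ht.ne'
  field_simp

/-- The prefactor and the slope inside the logarithm both have the sign of `1 - α²`. -/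
theorem timeChange_le_timeChange (hn : 0 < n) (hα : 1 - α ^ 2 ≠ 0) {s t : ℝ} (hst : s ≤ t)
    (hs : 0 < 2 * n * s * (1 - α ^ 2) + 1) (ht : 0 < 2 * n * t * (1 - α ^ 2) + 1) :
    timeChange n α s ≤ timeChange n α t := by
  have hn' : (0 : ℝ) < 2 * n := by positivity
  have hn1 := mul_le_mul_of_nonneg_left hst hn'.le
  unfold timeChange
  rcases lt_or_gt_of_ne hα with h | h
  · refine mul_le_mul_of_nonpos_left (Real.log_le_log ht ?_) ?_
    · linarith [mul_le_mul_of_nonpos_right hn1 h.le]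
    · exact one_div_nonpos.2 (mul_neg_of_pos_of_neg hn' h).le
  · refine mul_le_mul_of_nonneg_left (Real.log_le_log hs ?_) (by positivity)
    linarith [mul_le_mul_of_nonneg_right hn1 h.le]

theorem ordConnected_timeChange_preimage (hn : 0 < n) (hα : 1 - α ^ 2 ≠ 0) {I : Set ℝ}
    (hI : I.OrdConnected) :
    {t : ℝ | 0 < 2 * n * t * (1 - α ^ 2) + 1 ∧ timeChange n α t ∈ I}.OrdConnected := by
  refine ⟨fun r hr t ht s hs => ?_⟩
  have hn' : (0 : ℝ) < 2 * n := by positivity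
  have h1 := mul_le_mul_of_nonneg_left hs.1 hn'.le
  have h2 := mul_le_mul_of_nonneg_left hs.2 hn'.le
  have hpos : 0 < 2 * n * s * (1 - α ^ 2) + 1 := by
    rcases lt_or_gt_of_ne hα with h | h
    · linarith [mul_le_mul_of_nonpos_right h2 h.le, ht.1]
    · linarith [mul_le_mul_of_nonneg_right h1 h.le, hr.1]
  exact ⟨hpos, hI.out hr.2 ht.2 ⟨timeChange_le_timeChange hn hα hs.1 hr.1 hpos,
    timeChange_le_timeChange hn hα hs.2 hpos ht.1⟩⟩

end TimeChange

/-! ### Mean curvature flows -/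

section Flow

variable {m n : ℕ} {M : Type*} [TopologicalSpace M] [ChartedSpace (EuclideanSpace ℝ (Fin n)) M]

theorem IsMCF.mono {N : Set (LorentzSpace m)} {I J : Set ℝ} {ι : M → LorentzSpace m}
    {f : M → ℝ → LorentzSpace m} (hf : IsMCF n N I ι f) (hJI : J ⊆ I) (hJ : J.OrdConnected)
    (h0 : (0 : ℝ) ∈ J) : IsMCF n N J ι f where
  interval := hJ
  zero_mem := h0
  smooth := hf.smooth.mono (prod_mono subset_rfl hJI)
  initial := hf.initial
  mem t ht := hf.mem t (hJI ht)
  immersion t ht := hf.immersion t (hJI ht)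
  evolution t ht x := by
    obtain ⟨H, hH, hd⟩ := hf.evolution t (hJI ht) x
    exact ⟨H, hH, hd.mono hJI⟩

theorem IsMCF.isTheMCF {N : Set (LorentzSpace m)} {J : Set ℝ} {ι : M → LorentzSpace m}
    {f : M → ℝ → LorentzSpace m} (hf : IsMCF n N J ι f) : IsTheMCF n N J ι f :=
  ⟨hf, fun _ hJ' huniq F' hF' =>
    huniq F' f hF' (hf.mono hJ' hF'.interval hF'.zero_mem)⟩

/-- If the mean curvature vectors in `ℝ^{m,1}` and in `N` differ by `n (1 - α²) (f - η)`, then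
rescaling about `η` turns a flow in `N` into a flow in `ℝ^{m,1}`. -/
theorem IsMCF.homothety {N : Set (LorentzSpace m)} {I : Set ℝ}
    {ι : M → LorentzSpace m} {f : M → ℝ → LorentzSpace m} (hf : IsMCF n N I ι f) (hn : 0 < n)
    {α : ℝ} (hα : 1 - α ^ 2 ≠ 0) (η : LorentzSpace m)
    (hmean : ∀ t ∈ I, ∀ x H, IsMeanCurvatureVector n N (fun y => f y t) x H →
      IsMeanCurvatureVector n univ (fun y => f y t) x
        (H + (n * (1 - α ^ 2)) • (f x t - η))) :
    IsMCF n univ {t : ℝ | 0 < 2 * n * t * (1 - α ^ 2) + 1 ∧ timeChange n α t ∈ I} ι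
      (fun x t => Real.sqrt (2 * n * t * (1 - α ^ 2) + 1) • (f x (timeChange n α t) - η) + η) where
  interval := ordConnected_timeChange_preimage hn hα hf.interval
  zero_mem := by simpa [timeChange_zero] using hf.zero_mem
  smooth := by
    set J := {t : ℝ | 0 < 2 * n * t * (1 - α ^ 2) + 1 ∧ timeChange n α t ∈ I} with hJ
    have hsnd : ContMDiffOn ((𝓡 n).prod 𝓘(ℝ, ℝ)) 𝓘(ℝ, ℝ) ∞ (Prod.snd : M × ℝ → ℝ)
        (univ ×ˢ J) := contMDiffOn_snd
    have hs : ContMDiffOn ((𝓡 n).prod 𝓘(ℝ, ℝ)) 𝓘(ℝ, ℝ) ∞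
        (fun p : M × ℝ => timeChange n α p.2) (univ ×ˢ J) :=
      contDiffOn_timeChange.contMDiffOn.comp hsnd fun p hp => hp.2.1
    have hr : ContMDiffOn ((𝓡 n).prod 𝓘(ℝ, ℝ)) 𝓘(ℝ, ℝ) ∞
        (fun p : M × ℝ => Real.sqrt (2 * n * p.2 * (1 - α ^ 2) + 1)) (univ ×ˢ J) := by
      have h : ContDiffOn ℝ ∞ (fun t : ℝ => Real.sqrt (2 * n * t * (1 - α ^ 2) + 1))
          {t | 0 < 2 * n * t * (1 - α ^ 2) + 1} :=
        ContDiffOn.sqrt (by fun_prop) fun t ht => ne_of_gt ht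
      exact h.contMDiffOn.comp hsnd fun p hp => hp.2.1
    have hfs := hf.smooth.comp (contMDiffOn_fst.prodMk hs) fun p hp => ⟨trivial, hp.2.2⟩
    exact (hr.smul (hfs.sub contMDiffOn_const)).add contMDiffOn_const
  initial x := by simp [timeChange_zero, hf.initial]
  mem _ _ _ := trivial
  immersion t ht := by
    have hr := (Real.sqrt_pos.2 ht.1).ne'
    -- `r (f - η) + η = r f + (η - r η)`.
    have h := (hf.immersion _ ht.2).smul_add_const hr
      (η - Real.sqrt (2 * n * t * (1 - α ^ 2) + 1) • η)
    convert h using 2 with x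
    module
  evolution t ht x := by
    obtain ⟨H, hH, hd⟩ := hf.evolution _ ht.2 x
    have hr := Real.sqrt_pos.2 ht.1
    have hsq := Real.sq_sqrt ht.1.le
    have hmc := (hmean _ ht.2 x H hH).smul_add_const hr.ne'
      (η - Real.sqrt (2 * n * t * (1 - α ^ 2) + 1) • η)
    refine ⟨(Real.sqrt (2 * n * t * (1 - α ^ 2) + 1))⁻¹ •
      (H + (n * (1 - α ^ 2)) • (f x (timeChange n α t) - η)), ?_, ?_⟩
    · convert hmc using 2
      module
    · have h1 : HasDerivAt (fun t : ℝ => 2 * n * t * (1 - α ^ 2) + 1)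
          (2 * n * (1 - α ^ 2)) t := by
        have := (((hasDerivAt_id t).const_mul (2 * (n : ℝ))).mul_const (1 - α ^ 2)).add_const 1
        simpa using this
      have h2 := (h1.sqrt ht.1.ne').hasDerivWithinAt
        (s := {t : ℝ | 0 < 2 * n * t * (1 - α ^ 2) + 1 ∧ timeChange n α t ∈ I})
      have h3 := hd.scomp t ((hasDerivAt_timeChange hn hα ht.1).hasDerivWithinAt
        (s := {t : ℝ | 0 < 2 * n * t * (1 - α ^ 2) + 1 ∧ timeChange n α t ∈ I}))
        fun s hs => hs.2
      -- With `r` the square root, `r' = n (1 - α²) / r` and the time change has derivative `r⁻²`,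
      -- so the product rule gives `r⁻¹ (H + n (1 - α²) (f - η))`.
      refine ((h2.smul (h3.sub_const η)).add_const η).congr_deriv ?_
      rw [← hsq]
      set r := Real.sqrt (2 * n * t * (1 - α ^ 2) + 1)
      rw [Real.sqrt_sq hr.le]
      simp only [Function.comp]
      match_scalars <;> field_simp

/-- If the mean curvature vectors in `ℝ^{m,1}` and in `N` differ by a constant vector `c`, then
translation by `t c` turns a flow in `N` into a flow in `ℝ^{m,1}`. -/
theorem IsMCF.translate {N : Set (LorentzSpace m)} {I : Set ℝ}
    {ι : M → LorentzSpace m} {f : M → ℝ → LorentzSpace m} (hf : IsMCF n N I ι f)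
    (c : LorentzSpace m)
    (hmean : ∀ t ∈ I, ∀ x H, IsMeanCurvatureVector n N (fun y => f y t) x H →
      IsMeanCurvatureVector n univ (fun y => f y t) x (H + c)) :
    IsMCF n univ I ι (fun x t => f x t + t • c) where
  interval := hf.interval
  zero_mem := hf.zero_mem
  smooth := by
    have hsnd : ContMDiffOn ((𝓡 n).prod 𝓘(ℝ, ℝ)) 𝓘(ℝ, ℝ) ∞ (Prod.snd : M × ℝ → ℝ)
        (univ ×ˢ I) := contMDiffOn_snd
    exact hf.smooth.add (hsnd.smul contMDiffOn_const)
  initial x := by simp [hf.initial]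
  mem _ _ _ := trivial
  immersion t ht := by
    simpa using (hf.immersion t ht).smul_add_const one_ne_zero (t • c)
  evolution t ht x := by
    obtain ⟨H, hH, hd⟩ := hf.evolution t ht x
    refine ⟨H + c, ?_, ?_⟩
    · simpa using (hmean t ht x H hH).smul_add_const one_ne_zero (t • c)
    · have h := hd.add (((hasDerivAt_id t).smul_const c).hasDerivWithinAt (s := I))
      exact h.congr_deriv (by simp)

end Flow

theorem lemmaF {m n : ℕ} (hn : 0 < n)
    {M : Type*} [TopologicalSpace M] [ChartedSpace (EuclideanSpace ℝ (Fin n)) M]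
    [IsManifold (𝓡 n) ∞ M]
    -- the totally umbilical hypersurface `L(V, u)`
    (V : Submodule ℝ (LorentzSpace m)) (hV : Module.finrank ℝ V = m) (u : LorentzSpace m)
    -- the normal vector `ξ` and the constants `a`, `α`, `β`
    (ξ : LorentzSpace m) (hξ0 : ξ ≠ 0) (hξV : ∀ v ∈ V, lorentz v ξ = 0)
    (hξ : lorentz ξ ξ = 1 ∨ lorentz ξ ξ = -1 ∨ lorentz ξ ξ = 0)
    (a α β : ℝ) (ha : a = lorentz u ξ) (ha0 : 0 ≤ a)
    (hβ : β = 1 / Real.sqrt (lorentz ξ ξ + a ^ 2)) (hα : α = β * a)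
    -- `M` as a submanifold of `L(V, u)`, and its mean curvature flow there
    (ι : M → LorentzSpace m) (hι : IsRiemannianImmersion n ι)
    (hιL : ∀ x, ι x ∈ umbilicalHypersurface V u)
    (I : Set ℝ) (f₁ : M → ℝ → LorentzSpace m)
    (hf₁ : IsMCF n (umbilicalHypersurface V u) I ι f₁) :
    (α ≠ 1 → ∀ η : LorentzSpace m, η = (α * β / (1 - α ^ 2)) • ξ →
      IsTheMCF n univ {t : ℝ | 0 < 2 * n * t * (1 - α ^ 2) + 1 ∧ timeChange n α t ∈ I} ι
        (fun x t => Real.sqrt (2 * n * t * (1 - α ^ 2) + 1) • (f₁ x (timeChange n α t) - η) + η)) ∧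
    (α = 1 →
      IsTheMCF n univ I ι (fun x t => f₁ x t - (n * t * β) • ξ)) := by
  have hmean : ∀ t ∈ I, ∀ x H,
      IsMeanCurvatureVector n (umbilicalHypersurface V u) (fun y => f₁ y t) x H →
      IsMeanCurvatureVector n univ (fun y => f₁ y t) x
        (H + (n * (1 - α ^ 2)) • f₁ x t - (n * (α * β)) • ξ) := by
    intro t ht x H hH
    -- This positivity involves only `ξ` and `u`, so the initial immersion yields it for all times.
    have hQ := lorentz_self_add_sq_pos hn hι hξ0 hξV hιL x
    have h := hH.of_umbilicalHypersurface (hf₁.immersion t ht) hV hξ0 hξV (hf₁.mem t ht) hQ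
    rw [← ha] at h hQ
    have hβQ : β ^ 2 = 1 / (lorentz ξ ξ + a ^ 2) := by
      rw [hβ, div_pow, one_pow, Real.sq_sqrt hQ.le]
    have h1 : 1 - α ^ 2 = lorentz ξ ξ / (lorentz ξ ξ + a ^ 2) := by
      rw [hα, mul_pow, hβQ]
      field_simp
      ring
    have h2 : α * β = a / (lorentz ξ ξ + a ^ 2) := by
      rw [hα, show β * a * β = a * β ^ 2 by ring, hβQ]
      ring
    rw [h1, h2]
    convert h using 1
    module
  refine ⟨fun hα1 η hη => ?_, fun hα1 => ?_⟩
  -- The sign condition `a ≥ 0` excludes `α = -1`.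
  · have hα0 : 0 ≤ α := by
      rw [hα, hβ]
      positivity
    have hne : 1 - α ^ 2 ≠ 0 := by
      intro h
      exact hα1 ((pow_eq_one_iff_of_nonneg hα0 two_ne_zero).1 (by linarith))
    refine (hf₁.homothety hn hne η fun t ht x H hH => ?_).isTheMCF
    convert hmean t ht x H hH using 1
    rw [hη]
    match_scalars <;> field_simp
  · have h := hf₁.translate (-(n * β) • ξ) fun t ht x H hH => by
      convert hmean t ht x H hH using 1
      rw [hα1]
      module
    have heq : (fun x t => f₁ x t - (n * t * β) • ξ) =
        fun x t => f₁ x t + t • (-(n * β) • ξ) := by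
      funext x t
      module
    rw [heq]
    exact h.isTheMCF
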